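/- **Conventions.** A $\Pi^1_2$ principle $\mathsf P$ is a statement $(\forall X)[\mathrm{inst}_{\mathsf P}(X)\to(\exists Y)\,\mathrm{sol}_{\mathsf P}(X,Y)]$ of second-order arithmetic with $\mathrm{inst}_{\mathsf P},\mathrm{sol}_{\mathsf P}$ arithmetical formulas without parameters; the sets $X\subseteq\omega$ satisfying $\mathrm{inst}_{\mathsf P}$ are the $\mathsf P$-instances, and $Y$ is a solution to the instance $X$ if $\mathrm{sol}_{\mathsf P}(X,Y)$ holds. $\mathsf P$ implies $\mathsf Q$ over $\mathsf{RCA}_0$ if every model of $\mathsf{RCA}_0+\mathsf P$ is a model of $\mathsf Q$. An $m$-by-$k$ matrix $M=(\sigma_{i,j})_{i<m,\,j<k}$ of strings $\sigma_{i,j}\in 2^{<\omega}$ is *disjoint* if the strings in each row are pairwise incomparable for the prefix order. An $M$-*valuation* is a tuple $V=(V_{i,j})_{i<m,\,j<k}$ of finite sets $V_{i,j}\subseteq\{\tau\in 2^{<\omega}:\tau\succeq\sigma_{i,j}\}$; write $V>s$ if $|\tau|>s$ for all $i,j$ and all $\tau\in V_{i,j}$. A formula $\varphi$ with distinguished set variables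 $U_{i,j}$ ($i<m$, $j<k$) is *essential* in $M$ if for every $s\in\omega$ there is an $M$-valuation $V>s$ such that $\varphi(V)$ holds. Given $A_0,A_1\subseteq 2^{<\omega}$, $V$ *diagonalizes* against $A_0,A_1$ if for every $i<m$ there are $l,r<k$ with $V_{i,l}\subseteq A_0$ and $V_{i,r}\subseteq A_1$. A set $X\subseteq\omega$ is $n$-*fair* for $A_0,A_1$ if for every $m$, every $\Sigma^{0,X}_1$ formula $\varphi(U_{i,j}:i<m,\,j<2^nm)$ and every disjoint $m$-by-$2^nm$ matrix $M$ in which $\varphi$ is essential, there is an $M$-valuation $V$ diagonalizing against $A_0,A_1$ such that $\varphi(V)$ holds. $X$ is *fair* for $A_0,A_1$ if it is $n$-fair for $A_0,A_1$ for some $n\ge 1$. $\mathsf P$ *admits fairness preservation* if for all $A_0,A_1\subseteq 2^{<\omega}$, every $C$ which is fair for $A_0,A_1$ and every $\mathsf P$-instance $X\le_T C$, there is a solution $Y$ to $X$ such that $Y\oplus C$ is fair for $A_0,A_1$. **Lemma.** Let $\mathsf P$ and $\mathsf Q$ be $\Pi^1_2$ principles such that $\mathsf P$ admits fairness preservation and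 $\mathsf Q$ does not. Then $\mathsf P$ does not imply $\mathsf Q$ over $\mathsf{RCA}_0$. Moreover, this is witnessed by an $\omega$-model of the following form: there are $A_0,A_1\subseteq 2^{<\omega}$ and sets $X_0,X_1,\dots\subseteq\omega$ such that 1. for every $s$, $X_0\oplus\dots\oplus X_s$ is fair for $A_0,A_1$; 2. for every $s$, $X_{s+1}$ is a solution to some $\mathsf P$-instance computable in $X_0\oplus\dots\oplus X_s$, provided that such an instance exists; 3. $\mathcal I=\{Z:(\exists s)\,Z\le_T X_0\oplus\dots\oplus X_s\}$ is a Turing ideal; 4. some $\mathsf Q$-instance $J\le_T X_0$ has no solution in $\mathcal I$; 5. the $\omega$-structure with second-order part $\mathcal I$ is a model of $\mathsf{RCA}_0$ and of $\mathsf P$, but not of $\mathsf Q$. -/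

import Mathlib

/-! ## Second-order arithmetic -/

namespace SecondOrderArithmetic

/-- Number terms of the language of second-order arithmetic, with number variables `0, …, n-1`. -/
inductive NumTerm (n : ℕ) : Type where
  | var : Fin n → NumTerm n
  | zero : NumTerm n
  | one : NumTerm n
  | add : NumTerm n → NumTerm n → NumTerm n
  | mul : NumTerm n → NumTerm n → NumTerm n

/-- Formulas of the language of second-order arithmetic whose free number variables are among
`0, …, n-1` and whose free set variables are among `0, …, k-1`. A quantifier binds the last
variable of its scope. The bounded number quantifier `ball t φ` is `(∀ x < t) φ(x)`. -/
inductive Formula : ℕ → ℕ → Type where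
  | eq {n k : ℕ} : NumTerm n → NumTerm n → Formula n k
  | lt {n k : ℕ} : NumTerm n → NumTerm n → Formula n k
  | mem {n k : ℕ} : NumTerm n → Fin k → Formula n k
  | neg {n k : ℕ} : Formula n k → Formula n k
  | and {n k : ℕ} : Formula n k → Formula n k → Formula n k
  | ball {n k : ℕ} : NumTerm n → Formula (n + 1) k → Formula n k
  | all {n k : ℕ} : Formula (n + 1) k → Formula n k
  | allSet {n k : ℕ} : Formula n (k + 1) → Formula n k

namespace Formula

/-- Implication. -/
def imp {n k : ℕ} (φ ψ : Formula n k) : Formula n k := neg (and φ (neg ψ))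

/-- Existential number quantifier. -/
def ex {n k : ℕ} (φ : Formula (n + 1) k) : Formula n k := neg (all (neg φ))

/-- Existential set quantifier. -/
def exSet {n k : ℕ} (φ : Formula n (k + 1)) : Formula n k := neg (allSet (neg φ))

/-- `Δ⁰₀` formulas: all quantifiers are bounded number quantifiers. -/
def IsDelta0 : {n k : ℕ} → Formula n k → Prop
  | _, _, eq _ _ => True
  | _, _, lt _ _ => True
  | _, _, mem _ _ => True
  | _, _, neg φ => φ.IsDelta0
  | _, _, and φ ψ => φ.IsDelta0 ∧ ψ.IsDelta0
  | _, _, ball _ φ => φ.IsDelta0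
  | _, _, all _ => False
  | _, _, allSet _ => False

/-- Arithmetical formulas: no set quantifiers (free set variables are allowed). -/
def IsArithmetical : {n k : ℕ} → Formula n k → Prop
  | _, _, eq _ _ => True
  | _, _, lt _ _ => True
  | _, _, mem _ _ => True
  | _, _, neg φ => φ.IsArithmetical
  | _, _, and φ ψ => φ.IsArithmetical ∧ ψ.IsArithmetical
  | _, _, ball _ φ => φ.IsArithmetical
  | _, _, all φ => φ.IsArithmetical
  | _, _, allSet _ => False

/-- `Σ⁰₁` formulas `∃ x θ` with `θ` a `Δ⁰₀` formula. -/
def IsSigma1 {n k : ℕ} (φ : Formula n k) : Prop :=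
  ∃ θ : Formula (n + 1) k, θ.IsDelta0 ∧ φ = ex θ

/-- `Π⁰₁` formulas `∀ x θ` with `θ` a `Δ⁰₀` formula. -/
def IsPi1 {n k : ℕ} (φ : Formula n k) : Prop :=
  ∃ θ : Formula (n + 1) k, θ.IsDelta0 ∧ φ = all θ

end Formula

/-- A structure for the language of second-order arithmetic: a first-order part `N` with
interpretations of the symbols, and a collection `S` of subsets of `N` over which the set
quantifiers range. -/
structure L2Structure : Type 1 where
  /-- the first-order part -/
  N : Type
  /-- the second-order part -/
  S : Set (Set N)
  zero : N
  one : N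
  add : N → N → N
  mul : N → N → N
  lt : N → N → Prop

namespace L2Structure

/-- Value of a term. -/
def eval (M : L2Structure) {n : ℕ} (e : Fin n → M.N) : NumTerm n → M.N
  | .var i => e i
  | .zero => M.zero
  | .one => M.one
  | .add s t => M.add (M.eval e s) (M.eval e t)
  | .mul s t => M.mul (M.eval e s) (M.eval e t)

/-- Truth of a formula in a structure, under an assignment `e` of numbers and `E` of sets. -/
def Sat (M : L2Structure) :
    {n k : ℕ} → Formula n k → (Fin n → M.N) → (Fin k → Set M.N) → Prop
  | _, _, .eq s t, e, _ => M.eval e s = M.eval e t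
  | _, _, .lt s t, e, _ => M.lt (M.eval e s) (M.eval e t)
  | _, _, .mem t i, e, E => M.eval e t ∈ E i
  | _, _, .neg φ, e, E => ¬ M.Sat φ e E
  | _, _, .and φ ψ, e, E => M.Sat φ e E ∧ M.Sat ψ e E
  | _, _, .ball t φ, e, E => ∀ x : M.N, M.lt x (M.eval e t) → M.Sat φ (Fin.snoc e x) E
  | _, _, .all φ, e, E => ∀ x : M.N, M.Sat φ (Fin.snoc e x) E
  | _, _, .allSet φ, e, E => ∀ X ∈ M.S, M.Sat φ e (Fin.snoc E X)

/-- Truth of a sentence. -/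
def Models (M : L2Structure) (φ : Formula 0 0) : Prop := M.Sat φ Fin.elim0 Fin.elim0

/-- `M` is a model of `RCA₀`: the basic axioms, induction for `Σ⁰₁` formulas and comprehension
for `Δ⁰₁` formulas, where the formulas may have number parameters from `M.N` and set parameters
from `M.S`. -/
structure ModelsRCA0 (M : L2Structure) : Prop where
  succ_ne_zero : ∀ a : M.N, M.add a M.one ≠ M.zero
  succ_inj : ∀ a b : M.N, M.add a M.one = M.add b M.one → a = b
  add_zero : ∀ a : M.N, M.add a M.zero = a
  add_succ : ∀ a b : M.N, M.add a (M.add b M.one) = M.add (M.add a b) M.one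
  mul_zero : ∀ a : M.N, M.mul a M.zero = M.zero
  mul_succ : ∀ a b : M.N, M.mul a (M.add b M.one) = M.add (M.mul a b) a
  not_lt_zero : ∀ a : M.N, ¬ M.lt a M.zero
  lt_succ : ∀ a b : M.N, M.lt a (M.add b M.one) ↔ M.lt a b ∨ a = b
  sigma1_induction : ∀ (n k : ℕ) (φ : Formula (n + 1) k), φ.IsSigma1 →
    ∀ (e : Fin n → M.N) (E : Fin k → Set M.N), (∀ i, E i ∈ M.S) →
      M.Sat φ (Fin.snoc e M.zero) E →
      (∀ x : M.N, M.Sat φ (Fin.snoc e x) E → M.Sat φ (Fin.snoc e (M.add x M.one)) E) →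
      ∀ x : M.N, M.Sat φ (Fin.snoc e x) E
  delta1_comprehension : ∀ (n k : ℕ) (φ ψ : Formula (n + 1) k), φ.IsSigma1 → ψ.IsPi1 →
    ∀ (e : Fin n → M.N) (E : Fin k → Set M.N), (∀ i, E i ∈ M.S) →
      (∀ x : M.N, M.Sat φ (Fin.snoc e x) E ↔ M.Sat ψ (Fin.snoc e x) E) →
      ∃ X ∈ M.S, ∀ x : M.N, x ∈ X ↔ M.Sat φ (Fin.snoc e x) E

/-- The structure with the standard natural numbers and second-order part `S`. -/
def omega (S : Set (Set ℕ)) : L2Structure where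
  N := ℕ
  S := S
  zero := 0
  one := 1
  add := (· + ·)
  mul := (· * ·)
  lt := (· < ·)

end L2Structure

/-- A `Π¹₂` principle, presented as a problem: `(∀ X) [inst(X) → (∃ Y) sol(X, Y)]` with `inst` and
`sol` arithmetical formulas without parameters. -/
structure Principle : Type where
  inst : Formula 0 1
  sol : Formula 0 2
  inst_arithmetical : inst.IsArithmetical
  sol_arithmetical : sol.IsArithmetical

namespace Principle

/-- The sentence `(∀ X) [inst(X) → (∃ Y) sol(X, Y)]`. -/
def sentence (P : Principle) : Formula 0 0 := .allSet (.imp P.inst (.exSet P.sol))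

/-- `X` is a `P`-instance. -/
def IsInstance (P : Principle) (X : Set ℕ) : Prop :=
  (L2Structure.omega Set.univ).Sat P.inst Fin.elim0 ![X]

/-- `Y` is a solution to the `P`-instance `X`. -/
def IsSolution (P : Principle) (X Y : Set ℕ) : Prop :=
  (L2Structure.omega Set.univ).Sat P.sol Fin.elim0 ![X, Y]

end Principle

/-- `P` implies `Q` over `RCA₀`: every model of `RCA₀` in which `P` holds satisfies `Q`. -/
def ImpliesOverRCA0 (P Q : Principle) : Prop :=
  ∀ M : L2Structure, M.ModelsRCA0 → M.Models P.sentence → M.Models Q.sentence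

end SecondOrderArithmetic

/-! ## Turing reducibility for sets of natural numbers -/

namespace TuringSet

open Classical in
/-- The characteristic function of a set, as an oracle. -/
noncomputable def charFun (A : Set ℕ) : ℕ →. ℕ := fun n => Part.some (if n ∈ A then 1 else 0)

/-- `A ≤_T B`. -/
def Reducible (A B : Set ℕ) : Prop := TuringReducible (charFun A) (charFun B)

/-- `A ⊕ B = {2n : n ∈ A} ∪ {2n + 1 : n ∈ B}`. -/
def join (A B : Set ℕ) : Set ℕ := (fun n => 2 * n) '' A ∪ (fun n => 2 * n + 1) '' B

/-- `X₀ ⊕ ⋯ ⊕ X_s`. -/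
def joinUpTo (X : ℕ → Set ℕ) : ℕ → Set ℕ
  | 0 => X 0
  | s + 1 => join (joinUpTo X s) (X (s + 1))

/-- Turing ideals. -/
structure IsIdeal (I : Set (Set ℕ)) : Prop where
  nonempty : I.Nonempty
  downward_closed : ∀ A B : Set ℕ, B ∈ I → Reducible A B → A ∈ I
  join_closed : ∀ A B : Set ℕ, A ∈ I → B ∈ I → join A B ∈ I

end TuringSet

/-! ## Fairness -/

namespace Fairness

open SecondOrderArithmetic

/-- An `m`-by-`k` matrix of binary strings. -/
abbrev StringMatrix (m k : ℕ) : Type := Fin m → Fin k → List Bool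

/-- A matrix is disjoint if the strings in each row are pairwise incomparable for the prefix
order. -/
def StringMatrix.IsDisjoint {m k : ℕ} (M : StringMatrix m k) : Prop :=
  ∀ (i : Fin m) (j j' : Fin k), j ≠ j' → ¬ M i j <+: M i j'

/-- A tuple of finite sets of binary strings. -/
abbrev StringSets (m k : ℕ) : Type := Fin m → Fin k → Finset (List Bool)

/-- `V` is an `M`-valuation: every element of `V i j` extends `M i j`. -/
def IsValuation {m k : ℕ} (M : StringMatrix m k) (V : StringSets m k) : Prop :=
  ∀ (i : Fin m) (j : Fin k), ∀ τ ∈ V i j, M i j <+: τ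

/-- `V > s`. -/
def Above {m k : ℕ} (V : StringSets m k) (s : ℕ) : Prop :=
  ∀ (i : Fin m) (j : Fin k), ∀ τ ∈ V i j, s < τ.length

/-- An `m`-by-`k` formula with one further set variable for an oracle: the set variable `0` stands
for the oracle, and the `m * k` others for the distinguished variables `U i j`. -/
abbrev MatrixFormula (m k : ℕ) : Type := Formula 0 (m * k + 1)

/-- `φ(V)` with oracle `X`, in the standard natural numbers; binary strings are coded by natural
numbers in the standard way. -/
def Holds {m k : ℕ} (φ : MatrixFormula m k) (X : Set ℕ) (V : StringSets m k) : Prop :=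
  (L2Structure.omega Set.univ).Sat φ Fin.elim0
    (Fin.cons X fun p : Fin (m * k) =>
      Encodable.encode ''
        (V (finProdFinEquiv.symm p).1 (finProdFinEquiv.symm p).2 : Set (List Bool)))

/-- `φ` (with oracle `X`) is essential in `M`. -/
def IsEssential {m k : ℕ} (φ : MatrixFormula m k) (X : Set ℕ) (M : StringMatrix m k) : Prop :=
  ∀ s : ℕ, ∃ V : StringSets m k, IsValuation M V ∧ Above V s ∧ Holds φ X V

/-- `V` diagonalizes against `A₀, A₁`. -/
def Diagonalizes {m k : ℕ} (V : StringSets m k) (A₀ A₁ : Set (List Bool)) : Prop :=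
  ∀ i : Fin m, ∃ l r : Fin k, (V i l : Set (List Bool)) ⊆ A₀ ∧ (V i r : Set (List Bool)) ⊆ A₁

/-- `X` is `n`-fair for `A₀, A₁`. -/
def IsNFair (n : ℕ) (X : Set ℕ) (A₀ A₁ : Set (List Bool)) : Prop :=
  ∀ (m : ℕ) (φ : MatrixFormula m (2 ^ n * m)), φ.IsSigma1 →
    ∀ M : StringMatrix m (2 ^ n * m), M.IsDisjoint → IsEssential φ X M →
      ∃ V : StringSets m (2 ^ n * m),
        IsValuation M V ∧ Diagonalizes V A₀ A₁ ∧ Holds φ X V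

/-- `X` is fair for `A₀, A₁`. -/
def IsFair (X : Set ℕ) (A₀ A₁ : Set (List Bool)) : Prop :=
  ∃ n : ℕ, 1 ≤ n ∧ IsNFair n X A₀ A₁

/-- `P` admits fairness preservation. -/
def AdmitsPreservation (P : Principle) : Prop :=
  ∀ (A₀ A₁ : Set (List Bool)) (C : Set ℕ), IsFair C A₀ A₁ →
    ∀ X : Set ℕ, TuringSet.Reducible X C → P.IsInstance X →
      ∃ Y : Set ℕ, P.IsSolution X Y ∧ IsFair (TuringSet.join Y C) A₀ A₁

end Fairness

/-! Since `Q` fails to preserve fairness, there are `A₀`, `A₁`, a fair set `C` and a `Q`-instance `J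
≤_T C` such that `Y ⊕ C` is unfair for every solution `Y` of `J`. Put `X 0 = C` and iterate the
preservation property of `P`: each finite join stays fair, and bookkeeping ensures that every
`P`-instance computable from a finite join is eventually solved
(`AdmitsPreservation.exists_sequence`). The Turing ideal of the sets below these joins is then an
ω-model of `RCA₀` and of `P`. A solution `Z` of `J` in the ideal would make `Z ⊕ C` computable from
a fair join, hence fair (`IsFair.of_reducible`), a contradiction.

With formulas as syntax and reducibility as recursion in an oracle, two bridges are needed. Downward
closure of fairness requires that a `Σ⁰₁` formula in `Z ≤_T C` be equivalent to one in `C`; this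
rests on the arithmetization of relative recursion (`Sigma1Graph.of_recursiveIn`). Conversely,
comprehension in the ideal requires that `Δ⁰₁` sets be computable from their parameters
(`reducible_of_delta1`). The bookkeeping uses that each Turing lower cone is countable
(`exists_range_eq_reducible`). -/

namespace SecondOrderArithmetic

/-! ### Truth and substitution in ω-structures. -/

namespace NumTerm

/-- Value of a term in the standard natural numbers. -/
def val {n : ℕ} (e : Fin n → ℕ) : NumTerm n → ℕ
  | .var i => e i
  | .zero => 0
  | .one => 1
  | .add s t => s.val e + t.val e
  | .mul s t => s.val e * t.val e

/-- Simultaneous substitution of terms for variables. -/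
def subst {n m : ℕ} (σ : Fin n → NumTerm m) : NumTerm n → NumTerm m
  | .var i => σ i
  | .zero => .zero
  | .one => .one
  | .add s t => .add (s.subst σ) (t.subst σ)
  | .mul s t => .mul (s.subst σ) (t.subst σ)

theorem val_subst {n m : ℕ} (σ : Fin n → NumTerm m) (e : Fin m → ℕ) (t : NumTerm n) :
    (t.subst σ).val e = t.val fun i => (σ i).val e := by
  induction t <;> simp_all [subst, val]

/-- The extension of a substitution to the scope of a number quantifier. -/
def lift {n m : ℕ} (σ : Fin n → NumTerm m) : Fin (n + 1) → NumTerm (m + 1) :=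
  Fin.snoc (α := fun _ => NumTerm (m + 1))
    (fun i => (σ i).subst fun j => .var j.castSucc) (.var (Fin.last m))

theorem val_lift {n m : ℕ} (σ : Fin n → NumTerm m) (e : Fin m → ℕ) (x : ℕ) :
    (fun i => (lift σ i).val (Fin.snoc (α := fun _ => ℕ) e x)) =
      Fin.snoc (α := fun _ => ℕ) (fun i => (σ i).val e) x := by
  funext i
  refine Fin.lastCases ?_ (fun i => ?_) i <;> simp [lift, val, val_subst]

end NumTerm

namespace Formula

/-- Truth in the `ω`-structure with second-order part `S`. -/
def Realize (S : Set (Set ℕ)) :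
    {n k : ℕ} → Formula n k → (Fin n → ℕ) → (Fin k → Set ℕ) → Prop
  | _, _, .eq s t, e, _ => s.val e = t.val e
  | _, _, .lt s t, e, _ => s.val e < t.val e
  | _, _, .mem t i, e, E => t.val e ∈ E i
  | _, _, .neg φ, e, E => ¬ φ.Realize S e E
  | _, _, .and φ ψ, e, E => φ.Realize S e E ∧ ψ.Realize S e E
  | _, _, .ball t φ, e, E => ∀ x < t.val e, φ.Realize S (Fin.snoc (α := fun _ => ℕ) e x) E
  | _, _, .all φ, e, E => ∀ x, φ.Realize S (Fin.snoc (α := fun _ => ℕ) e x) E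
  | _, _, .allSet φ, e, E => ∀ X ∈ S, φ.Realize S e (Fin.snoc (α := fun _ => Set ℕ) E X)

theorem eval_omega (S : Set (Set ℕ)) {n : ℕ} (e : Fin n → ℕ) (t : NumTerm n) :
    (L2Structure.omega S).eval e t = t.val e := by
  induction t with
  | var i => rfl
  | zero => rfl
  | one => rfl
  | add s t hs ht => exact congrArg₂ (· + ·) hs ht
  | mul s t hs ht => exact congrArg₂ (· * ·) hs ht

theorem sat_omega (S : Set (Set ℕ)) {n k : ℕ} (φ : Formula n k) (e : Fin n → ℕ)
    (E : Fin k → Set ℕ) : (L2Structure.omega S).Sat φ e E ↔ φ.Realize S e E := by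
  induction φ with
  | eq s t => exact Iff.of_eq (congrArg₂ (· = ·) (eval_omega S e s) (eval_omega S e t))
  | lt s t => exact Iff.of_eq (congrArg₂ (· < ·) (eval_omega S e s) (eval_omega S e t))
  | mem t i => exact Iff.of_eq (congrArg (· ∈ E i) (eval_omega S e t))
  | neg φ ih => exact not_congr (ih e E)
  | and φ ψ ih₁ ih₂ => exact and_congr (ih₁ e E) (ih₂ e E)
  | ball t φ ih =>
    exact forall_congr' fun x : ℕ => imp_congr
      (Iff.of_eq (congrArg (LT.lt (α := ℕ) x) (eval_omega S e t))) (ih _ E)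
  | all φ ih => exact forall_congr' fun x => ih _ E
  | allSet φ ih => exact forall₂_congr fun X _ => ih e _

theorem realize_ex (S : Set (Set ℕ)) {n k : ℕ} (φ : Formula (n + 1) k) (e : Fin n → ℕ)
    (E : Fin k → Set ℕ) :
    φ.ex.Realize S e E ↔ ∃ x, φ.Realize S (Fin.snoc (α := fun _ => ℕ) e x) E := by
  simp [ex, Realize]

theorem realize_exSet (S : Set (Set ℕ)) {n k : ℕ} (φ : Formula n (k + 1)) (e : Fin n → ℕ)
    (E : Fin k → Set ℕ) :
    φ.exSet.Realize S e E ↔ ∃ X ∈ S, φ.Realize S e (Fin.snoc (α := fun _ => Set ℕ) E X) := by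
  simp [exSet, Realize]

theorem realize_imp (S : Set (Set ℕ)) {n k : ℕ} (φ ψ : Formula n k) (e : Fin n → ℕ)
    (E : Fin k → Set ℕ) :
    (φ.imp ψ).Realize S e E ↔ (φ.Realize S e E → ψ.Realize S e E) := by
  simp [imp, Realize]

/-- Without set quantifiers the second-order part is never consulted. Hence being an instance or a
solution, defined over all subsets of `ℕ`, means the same inside a Turing ideal. -/
theorem IsArithmetical.realize_iff {n k : ℕ} {φ : Formula n k} (h : φ.IsArithmetical)
    (S T : Set (Set ℕ)) (e : Fin n → ℕ) (E : Fin k → Set ℕ) :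
    φ.Realize S e E ↔ φ.Realize T e E := by
  induction φ with
  | eq s t => exact Iff.rfl
  | lt s t => exact Iff.rfl
  | mem t i => exact Iff.rfl
  | neg φ ih => exact not_congr (ih h e E)
  | and φ ψ ih₁ ih₂ => exact and_congr (ih₁ h.1 e E) (ih₂ h.2 e E)
  | ball t φ ih => exact forall₂_congr fun x _ => ih h _ E
  | all φ ih => exact forall_congr' fun x => ih h _ E
  | allSet φ ih => exact h.elim

theorem IsDelta0.isArithmetical {n k : ℕ} {φ : Formula n k} (h : φ.IsDelta0) :
    φ.IsArithmetical := by
  induction φ with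
  | eq s t => trivial
  | lt s t => trivial
  | mem t i => trivial
  | neg φ ih => exact ih h
  | and φ ψ ih₁ ih₂ => exact ⟨ih₁ h.1, ih₂ h.2⟩
  | ball t φ ih => exact ih h
  | all φ ih => exact h.elim
  | allSet φ ih => exact h.elim

/-- Simultaneous substitution of terms for number variables. -/
def subst : {n k m : ℕ} → (Fin n → NumTerm m) → Formula n k → Formula m k
  | _, _, _, σ, .eq s t => .eq (s.subst σ) (t.subst σ)
  | _, _, _, σ, .lt s t => .lt (s.subst σ) (t.subst σ)
  | _, _, _, σ, .mem t i => .mem (t.subst σ) i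
  | _, _, _, σ, .neg φ => .neg (φ.subst σ)
  | _, _, _, σ, .and φ ψ => .and (φ.subst σ) (ψ.subst σ)
  | _, _, _, σ, .ball t φ => .ball (t.subst σ) (φ.subst (NumTerm.lift σ))
  | _, _, _, σ, .all φ => .all (φ.subst (NumTerm.lift σ))
  | _, _, _, σ, .allSet φ => .allSet (φ.subst σ)

theorem realize_subst (S : Set (Set ℕ)) {n k : ℕ} (φ : Formula n k) :
    ∀ {m : ℕ} (σ : Fin n → NumTerm m) (e : Fin m → ℕ) (E : Fin k → Set ℕ),
      (φ.subst σ).Realize S e E ↔ φ.Realize S (fun i => (σ i).val e) E := by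
  induction φ with
  | eq s t => intros; simp [subst, Realize, NumTerm.val_subst]
  | lt s t => intros; simp [subst, Realize, NumTerm.val_subst]
  | mem t i => intros; simp [subst, Realize, NumTerm.val_subst]
  | neg φ ih => intros; simp [subst, Realize, ih]
  | and φ ψ ih₁ ih₂ => intros; simp [subst, Realize, ih₁, ih₂]
  | ball t φ ih => intros; simp [subst, Realize, ih, NumTerm.val_subst, NumTerm.val_lift]
  | all φ ih => intros; simp [subst, Realize, ih, NumTerm.val_lift]
  | allSet φ ih => intros; simp [subst, Realize, ih]

theorem IsDelta0.subst {n k : ℕ} {φ : Formula n k} (h : φ.IsDelta0) :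
    ∀ {m : ℕ} (σ : Fin n → NumTerm m), (φ.subst σ).IsDelta0 := by
  induction φ with
  | eq s t => intros; trivial
  | lt s t => intros; trivial
  | mem t i => intros; trivial
  | neg φ ih => intro m σ; exact ih h σ
  | and φ ψ ih₁ ih₂ => intro m σ; exact ⟨ih₁ h.1 σ, ih₂ h.2 σ⟩
  | ball t φ ih => intro m σ; exact ih h _
  | all φ ih => exact h.elim
  | allSet φ ih => exact h.elim

end Formula

/-! ### Definability with respect to a family of assignments of sets -/

/-- Functions of number variables given by terms. -/
def IsTermFun {n : ℕ} (f : (Fin n → ℕ) → ℕ) : Prop := ∃ t : NumTerm n, ∀ e, t.val e = f e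

namespace IsTermFun

variable {n : ℕ} {f g : (Fin n → ℕ) → ℕ}

theorem var (i : Fin n) : IsTermFun fun e => e i := ⟨.var i, fun _ => rfl⟩

theorem add (hf : IsTermFun f) (hg : IsTermFun g) : IsTermFun fun e => f e + g e := by
  obtain ⟨s, hs⟩ := hf
  obtain ⟨t, ht⟩ := hg
  exact ⟨.add s t, fun e => by simp [NumTerm.val, hs, ht]⟩

theorem mul (hf : IsTermFun f) (hg : IsTermFun g) : IsTermFun fun e => f e * g e := by
  obtain ⟨s, hs⟩ := hf
  obtain ⟨t, ht⟩ := hg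
  exact ⟨.mul s t, fun e => by simp [NumTerm.val, hs, ht]⟩

theorem const (c : ℕ) : IsTermFun fun _ : Fin n → ℕ => c := by
  induction c with
  | zero => exact ⟨.zero, fun _ => rfl⟩
  | succ c ih => exact ih.add ⟨.one, fun _ => rfl⟩

theorem init (hf : IsTermFun f) : IsTermFun fun e : Fin (n + 1) → ℕ => f (Fin.init e) := by
  obtain ⟨t, ht⟩ := hf
  exact ⟨t.subst fun j => .var j.castSucc, fun e => (NumTerm.val_subst _ _ _).trans (ht _)⟩

theorem last : IsTermFun fun e : Fin (n + 1) → ℕ => e (Fin.last n) := var _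

end IsTermFun

section Definability

variable {U : Type*} {k : ℕ} (E : U → Fin k → Set ℕ)

/-- Relations that are uniformly `Δ⁰₀` in the sets of the assignments `E u`. -/
def Delta0Def {n : ℕ} (R : (Fin n → ℕ) → U → Prop) : Prop :=
  ∃ θ : Formula n k, θ.IsDelta0 ∧ ∀ e u, θ.Realize Set.univ e (E u) ↔ R e u

/-- Relations that are uniformly `Σ⁰₁` in the sets of the assignments `E u`. -/
def Sigma1Def {n : ℕ} (R : (Fin n → ℕ) → U → Prop) : Prop :=
  ∃ θ : Formula (n + 1) k, θ.IsDelta0 ∧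
    ∀ e u, (∃ x, θ.Realize Set.univ (Fin.snoc (α := fun _ => ℕ) e x) (E u)) ↔ R e u

variable {E} {n : ℕ} {R Q : (Fin n → ℕ) → U → Prop} {f g h : (Fin n → ℕ) → ℕ}

namespace Delta0Def

theorem congr (hR : Delta0Def E R) (H : ∀ e u, R e u ↔ Q e u) : Delta0Def E Q := by
  obtain ⟨θ, h, hθ⟩ := hR
  exact ⟨θ, h, fun e u => (hθ e u).trans (H e u)⟩

theorem eq (hf : IsTermFun f) (hg : IsTermFun g) : Delta0Def E fun e _ => f e = g e := by
  obtain ⟨s, hs⟩ := hf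
  obtain ⟨t, ht⟩ := hg
  exact ⟨.eq s t, trivial, fun e u => by simp [Formula.Realize, hs, ht]⟩

theorem lt (hf : IsTermFun f) (hg : IsTermFun g) : Delta0Def E fun e _ => f e < g e := by
  obtain ⟨s, hs⟩ := hf
  obtain ⟨t, ht⟩ := hg
  exact ⟨.lt s t, trivial, fun e u => by simp [Formula.Realize, hs, ht]⟩

theorem mem (hf : IsTermFun f) (i : Fin k) : Delta0Def E fun e u => f e ∈ E u i := by
  obtain ⟨s, hs⟩ := hf
  exact ⟨.mem s i, trivial, fun e u => by simp [Formula.Realize, hs]⟩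

theorem not (hR : Delta0Def E R) : Delta0Def E fun e u => ¬ R e u := by
  obtain ⟨θ, h, hθ⟩ := hR
  exact ⟨.neg θ, h, fun e u => not_congr (hθ e u)⟩

theorem and (hR : Delta0Def E R) (hQ : Delta0Def E Q) :
    Delta0Def E fun e u => R e u ∧ Q e u := by
  obtain ⟨θ, h, hθ⟩ := hR
  obtain ⟨η, h', hη⟩ := hQ
  exact ⟨.and θ η, ⟨h, h'⟩, fun e u => and_congr (hθ e u) (hη e u)⟩

theorem or (hR : Delta0Def E R) (hQ : Delta0Def E Q) :
    Delta0Def E fun e u => R e u ∨ Q e u :=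
  (hR.not.and hQ.not).not.congr fun _ _ => by tauto

theorem ball {R : (Fin n → ℕ) → ℕ → U → Prop} (hf : IsTermFun f)
    (hR : Delta0Def E fun (e : Fin (n + 1) → ℕ) u => R (Fin.init e) (e (Fin.last n)) u) :
    Delta0Def E fun e u => ∀ x < f e, R e x u := by
  obtain ⟨t, ht⟩ := hf
  obtain ⟨θ, h, hθ⟩ := hR
  refine ⟨.ball t θ, h, fun e u => ?_⟩
  simp [Formula.Realize, ht, hθ]

theorem bex {R : (Fin n → ℕ) → ℕ → U → Prop} (hf : IsTermFun f)
    (hR : Delta0Def E fun (e : Fin (n + 1) → ℕ) u => R (Fin.init e) (e (Fin.last n)) u) :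
    Delta0Def E fun e u => ∃ x < f e, R e x u :=
  (ball (R := fun e x u => ¬ R e x u) hf hR.not).not.congr fun _ _ => by push Not; rfl

theorem comp {m : ℕ} (hR : Delta0Def E R) {σ : (Fin m → ℕ) → Fin n → ℕ}
    (hσ : ∀ i, IsTermFun fun e => σ e i) : Delta0Def E fun e u => R (σ e) u := by
  obtain ⟨θ, h, hθ⟩ := hR
  choose s hs using hσ
  refine ⟨θ.subst s, h.subst s, fun e u => ?_⟩
  rw [Formula.realize_subst, hθ]
  simp [hs]

end Delta0Def

namespace Sigma1Def

theorem iff_exists_delta0Def : Sigma1Def E R ↔ ∃ Q : (Fin (n + 1) → ℕ) → U → Prop,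
    Delta0Def E Q ∧ ∀ e u, R e u ↔ ∃ x, Q (Fin.snoc (α := fun _ => ℕ) e x) u := by
  constructor
  · rintro ⟨θ, h, hθ⟩
    exact ⟨fun e u => θ.Realize Set.univ e (E u), ⟨θ, h, fun _ _ => Iff.rfl⟩,
      fun e u => (hθ e u).symm⟩
  · rintro ⟨Q, ⟨θ, h, hθ⟩, hQ⟩
    exact ⟨θ, h, fun e u => by simp [hθ, hQ]⟩

theorem congr (hR : Sigma1Def E R) (H : ∀ e u, R e u ↔ Q e u) : Sigma1Def E Q := by
  obtain ⟨θ, h, hθ⟩ := hR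
  exact ⟨θ, h, fun e u => (hθ e u).trans (H e u)⟩

end Sigma1Def

theorem Delta0Def.sigma1Def (hR : Delta0Def E R) : Sigma1Def E R :=
  Sigma1Def.iff_exists_delta0Def.2 ⟨fun e u => R (Fin.init e) u,
    hR.comp fun i => (IsTermFun.var i).init, fun e u => by simp⟩

namespace Sigma1Def

/-- Two unbounded existential quantifiers merge into one: the new variable bounds both witnesses. -/
theorem ex {R : (Fin n → ℕ) → ℕ → U → Prop}
    (hR : Sigma1Def E fun (e : Fin (n + 1) → ℕ) u => R (Fin.init e) (e (Fin.last n)) u) :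
    Sigma1Def E fun e u => ∃ x, R e x u := by
  obtain ⟨Q, hQ, H⟩ := iff_exists_delta0Def.1 hR
  refine iff_exists_delta0Def.2 ⟨fun e u => ∃ y < e (Fin.last n) + 1, ∃ x < e (Fin.last n) + 1,
    Q (Fin.snoc (α := fun _ => ℕ) (Fin.snoc (α := fun _ => ℕ) (Fin.init e) y) x) u, ?_, ?_⟩
  · refine .bex (IsTermFun.last.add (.const 1)) (.bex (IsTermFun.last.add (.const 1)).init ?_)
    refine hQ.comp fun i => ?_
    refine Fin.lastCases ?_ (fun i => Fin.lastCases ?_ (fun i => ?_) i) i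
    · simpa using IsTermFun.last
    · simpa using IsTermFun.last.init
    · simpa using (IsTermFun.var i).init.init.init
  · intro e u
    have H' : ∀ y, R e y u ↔
        ∃ x, Q (Fin.snoc (α := fun _ => ℕ) (Fin.snoc (α := fun _ => ℕ) e y) x) u := fun y => by
      simpa using H (Fin.snoc (α := fun _ => ℕ) e y) u
    simp only [H', Fin.init_snoc, Fin.snoc_last]
    constructor
    · rintro ⟨y, x, h⟩
      exact ⟨max y x, y, by omega, x, by omega, h⟩
    · rintro ⟨-, y, -, x, -, h⟩
      exact ⟨y, x, h⟩

theorem and (hR : Sigma1Def E R) (hQ : Sigma1Def E Q) :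
    Sigma1Def E fun e u => R e u ∧ Q e u := by
  obtain ⟨R', hR', HR⟩ := iff_exists_delta0Def.1 hR
  obtain ⟨Q', hQ', HQ⟩ := iff_exists_delta0Def.1 hQ
  have key : Sigma1Def E fun e u => ∃ x, ∃ y, R' (Fin.snoc (α := fun _ => ℕ) e x) u ∧
      Q' (Fin.snoc (α := fun _ => ℕ) e y) u := by
    refine .ex (.ex (Delta0Def.sigma1Def (.and (hR'.comp fun i => ?_) (hQ'.comp fun i => ?_))))
    · refine Fin.lastCases ?_ (fun i => ?_) i
      · simpa using IsTermFun.last.init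
      · simpa using (IsTermFun.var i).init.init
    · refine Fin.lastCases ?_ (fun i => ?_) i
      · simpa using IsTermFun.last
      · simpa using (IsTermFun.var i).init.init
  exact key.congr fun e u => by simp [HR, HQ]

theorem or (hR : Sigma1Def E R) (hQ : Sigma1Def E Q) :
    Sigma1Def E fun e u => R e u ∨ Q e u := by
  obtain ⟨R', hR', HR⟩ := iff_exists_delta0Def.1 hR
  obtain ⟨Q', hQ', HQ⟩ := iff_exists_delta0Def.1 hQ
  exact iff_exists_delta0Def.2 ⟨fun e u => R' e u ∨ Q' e u, hR'.or hQ',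
    fun e u => by simp [HR, HQ, exists_or]⟩

/-- This is `Σ⁰₁` collection: finitely many witnesses have a common bound, which can be quantified
in front of the bounded quantifier. -/
theorem ball {R : (Fin n → ℕ) → ℕ → U → Prop} (hf : IsTermFun f)
    (hR : Sigma1Def E fun (e : Fin (n + 1) → ℕ) u => R (Fin.init e) (e (Fin.last n)) u) :
    Sigma1Def E fun e u => ∀ x < f e, R e x u := by
  obtain ⟨Q, hQ, H⟩ := iff_exists_delta0Def.1 hR
  have key : Sigma1Def E fun e u => ∃ z, ∀ y < f e, ∃ x < z,
      Q (Fin.snoc (α := fun _ => ℕ) (Fin.snoc (α := fun _ => ℕ) e y) x) u := by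
    refine .ex (Delta0Def.sigma1Def (.ball hf.init
      (.bex IsTermFun.last.init (hQ.comp fun i => ?_))))
    refine Fin.lastCases ?_ (fun i => Fin.lastCases ?_ (fun i => ?_) i) i
    · simpa using IsTermFun.last
    · simpa using IsTermFun.last.init
    · simpa using (IsTermFun.var i).init.init.init
  refine key.congr fun e u => ?_
  have H' : ∀ y, R e y u ↔
      ∃ x, Q (Fin.snoc (α := fun _ => ℕ) (Fin.snoc (α := fun _ => ℕ) e y) x) u := fun y => by
    simpa using H (Fin.snoc (α := fun _ => ℕ) e y) u
  simp only [H']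
  constructor
  · rintro ⟨z, hz⟩ y hy
    obtain ⟨x, -, h⟩ := hz y hy
    exact ⟨x, h⟩
  · intro h
    choose! w hw using h
    exact ⟨(Finset.range (f e)).sup w + 1, fun y hy => ⟨w y,
      Nat.lt_succ_of_le (Finset.le_sup (Finset.mem_range.2 hy)), hw y hy⟩⟩

theorem eq (hf : IsTermFun f) (hg : IsTermFun g) : Sigma1Def E fun e _ => f e = g e :=
  (Delta0Def.eq hf hg).sigma1Def

theorem lt (hf : IsTermFun f) (hg : IsTermFun g) : Sigma1Def E fun e _ => f e < g e :=
  (Delta0Def.lt hf hg).sigma1Def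

theorem pair_eq (hf : IsTermFun f) (hg : IsTermFun g) (hh : IsTermFun h) :
    Sigma1Def E fun e _ => Nat.pair (f e) (g e) = h e := by
  refine (((lt hf hg).and (eq ((hg.mul hg).add hf) hh)).or
    ((Delta0Def.lt hf hg).not.sigma1Def.and
      (eq (((hf.mul hf).add hf).add hg) hh))).congr fun e u => ?_
  by_cases hlt : f e < g e <;> simp [Nat.pair, hlt]

/-- `Nat.beta` is a remainder, so its graph is described by a quotient `q` and a remainder below the
modulus. It supplies codes for finite sequences. -/
theorem beta_eq (hf : IsTermFun f) (hg : IsTermFun g) (hh : IsTermFun h) :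
    Sigma1Def E fun e _ => Nat.beta (f e) (g e) = h e := by
  have key : Sigma1Def E fun e _ => ∃ c d q, Nat.pair c d = f e ∧
      h e < (g e + 1) * d + 1 ∧ c = q * ((g e + 1) * d + 1) + h e := by
    have hmod : IsTermFun fun e : Fin (n + 1 + 1 + 1) → ℕ =>
        (g (Fin.init (Fin.init (Fin.init e))) + 1) * Fin.init e (Fin.last (n + 1)) + 1 :=
      ((hg.init.init.init.add (.const 1)).mul IsTermFun.last.init).add (.const 1)
    exact .ex (.ex (.ex ((pair_eq IsTermFun.last.init.init IsTermFun.last.init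
      hf.init.init.init).and ((lt hh.init.init.init hmod).and
        (eq IsTermFun.last.init.init ((IsTermFun.last.mul hmod).add hh.init.init.init))))))
  refine key.congr fun e _ => ?_
  rw [Nat.beta]
  constructor
  · rintro ⟨c, d, q, h₁, h₂, h₃⟩
    rw [← h₁, Nat.unpair_pair]
    dsimp only
    rw [h₃, Nat.mul_add_mod_self_right]
    exact Nat.mod_eq_of_lt h₂
  · intro H
    refine ⟨_, _, (f e).unpair.1 / ((g e + 1) * (f e).unpair.2 + 1), Nat.pair_unpair _, ?_, ?_⟩
    · rw [← H]
      exact Nat.mod_lt _ (Nat.succ_pos _)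
    · rw [← H]
      exact (Nat.div_add_mod' _ _).symm

end Sigma1Def

end Definability

end SecondOrderArithmetic

/-! ### Arithmetization of relative recursion, and `Σ⁰₁` formulas under change of oracle. -/

namespace SecondOrderArithmetic

section SigmaRecursive

variable {U : Type*} {k : ℕ} {E : U → Fin k → Set ℕ}

/-- The graph of the partial function `F` is uniformly `Σ⁰₁`. -/
def Sigma1Graph (E : U → Fin k → Set ℕ) (F : ℕ →. ℕ) : Prop :=
  ∀ (n : ℕ) (f g : (Fin n → ℕ) → ℕ), IsTermFun f → IsTermFun g →
    Sigma1Def E fun e _ => g e ∈ F (f e)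

namespace Sigma1Graph

-- A value of a primitive recursion is certified by its sequence of intermediate values, coded by
-- one number `w` through Gödel's beta function.
open IsTermFun in
theorem prec {F H : ℕ →. ℕ} (hF : Sigma1Graph E F) (hH : Sigma1Graph E H) :
    Sigma1Graph E fun p => Nat.rec (F p.unpair.1)
      (fun y IH => IH >>= fun i => H (Nat.pair p.unpair.1 (Nat.pair y i))) p.unpair.2 := by
  intro n f g hf hg
  have key : Sigma1Def E fun e _ => ∃ a m w v, Nat.pair a m = f e ∧ Nat.beta w 0 = v ∧
      v ∈ F a ∧ Nat.beta w m = g e ∧ ∀ y < m, ∃ i j q r, Nat.beta w y = i ∧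
        Nat.beta w (y + 1) = j ∧ Nat.pair y i = q ∧ Nat.pair a q = r ∧ j ∈ H r := by
    refine .ex (.ex (.ex (.ex ?_)))
    refine .and ?_ (.and ?_ (.and ?_ (.and ?_ (.ball last.init.init ?_))))
    rotate_left 4
    · refine .ex (.ex (.ex (.ex ?_)))
      refine .and ?_ (.and ?_ (.and ?_ (.and ?_ ?_)))
      · exact .beta_eq last.init.init.init.init.init.init last.init.init.init.init
          last.init.init.init
      · exact .beta_eq last.init.init.init.init.init.init
          (last.init.init.init.init.add (.const 1)) last.init.init
      · exact .pair_eq last.init.init.init.init last.init.init.init last.init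
      · exact .pair_eq last.init.init.init.init.init.init.init.init last.init last
      · exact hH _ _ _ last last.init.init
    · exact .pair_eq last.init.init.init last.init.init hf.init.init.init.init
    · exact .beta_eq last.init (.const 0) last
    · exact hF _ _ _ last.init.init.init last
    · exact .beta_eq last.init last.init.init hg.init.init.init.init
  refine key.congr fun e _ => ?_
  change _ ↔ g e ∈ (Nat.rec (F (f e).unpair.1) (fun y IH => IH >>= fun i =>
    H (Nat.pair (f e).unpair.1 (Nat.pair y i))) (f e).unpair.2 : Part ℕ)
  constructor
  · rintro ⟨a, m, w, v, hp, hv, hva, hg, hy⟩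
    rw [← hp, Nat.unpair_pair, ← hg]
    clear hg hp
    induction m with
    | zero => simpa [hv] using hva
    | succ m ih =>
      obtain ⟨i, j, q, r, hi, hj, rfl, rfl, hjr⟩ := hy m (Nat.lt_succ_self m)
      exact Part.mem_bind (ih fun y hy' => hy y (Nat.lt_succ_of_lt hy')) (by rwa [hi, hj])
  · intro H'
    generalize ha : (f e).unpair.1 = a at H'
    generalize hm : (f e).unpair.2 = m at H'
    have hp : Nat.pair a m = f e := by rw [← ha, ← hm, Nat.pair_unpair]
    -- Convergence of the recursion yields an actual run `c`, extended by one value at each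
    -- successor; `Nat.unbeta` then codes it.
    obtain ⟨c, hc0, hcm, hc⟩ : ∃ c : ℕ → ℕ, c 0 ∈ F a ∧ c m = g e ∧
        ∀ y < m, c (y + 1) ∈ H (Nat.pair a (Nat.pair y (c y))) := by
      clear hp hm
      generalize g e = b at H'
      induction m generalizing b with
      | zero => exact ⟨fun _ => b, H', rfl, fun y hy => absurd hy (Nat.not_lt_zero y)⟩
      | succ m ih =>
        obtain ⟨i, hi, hb⟩ := Part.mem_bind_iff.1 H'
        obtain ⟨c, h₁, h₂, h₃⟩ := ih i hi
        refine ⟨Function.update c (m + 1) b, ?_, by simp, fun y hy => ?_⟩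
        · simpa using h₁
        · rcases Nat.lt_succ_iff_lt_or_eq.1 hy with hy | rfl
          · rw [Function.update_of_ne (by omega), Function.update_of_ne (by omega)]
            exact h₃ y hy
          · rw [Function.update_self, Function.update_of_ne (by omega), h₂]
            exact hb
    have hw : ∀ y ≤ m, Nat.beta (Nat.unbeta ((List.range (m + 1)).map c)) y = c y := by
      intro y hy
      simpa using Nat.beta_unbeta_coe ((List.range (m + 1)).map c)
        ⟨y, by simpa using hy⟩
    exact ⟨a, m, _, c 0, hp, hw 0 (Nat.zero_le m), hc0, (hw m le_rfl).trans hcm,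
      fun y hy => ⟨c y, c (y + 1), _, _, hw y hy.le, hw (y + 1) hy, rfl, rfl, hc y hy⟩⟩

-- Minimality stays `Σ⁰₁` because earlier values are required to converge to something positive,
-- which is a positive statement under a bounded quantifier.
open IsTermFun in
theorem rfind {F : ℕ →. ℕ} (hF : Sigma1Graph E F) :
    Sigma1Graph E fun a => Nat.rfind fun n => (fun m => m = 0) <$> F (Nat.pair a n) := by
  intro n f g hf hg
  have key : Sigma1Def E fun e _ => (∃ p z, Nat.pair (f e) (g e) = p ∧ z = 0 ∧ z ∈ F p) ∧
      ∀ m < g e, ∃ p z, Nat.pair (f e) m = p ∧ 0 < z ∧ z ∈ F p := by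
    refine .and (.ex (.ex (.and ?_ (.and ?_ ?_)))) (.ball hg (.ex (.ex (.and ?_ (.and ?_ ?_)))))
    · exact .pair_eq hf.init.init hg.init.init last.init
    · exact .eq last (.const 0)
    · exact hF _ _ _ last.init last
    · exact .pair_eq hf.init.init.init last.init.init last.init
    · exact .lt (.const 0) last
    · exact hF _ _ _ last.init last
  refine key.congr fun e _ => ?_
  refine Iff.trans ?_ Nat.mem_rfind.symm
  refine and_congr ?_ (forall₂_congr fun m _ => ?_) <;> simp [Nat.pos_iff_ne_zero, and_comm]

open IsTermFun in
theorem of_recursiveIn {O : Set (ℕ →. ℕ)} (hO : ∀ F ∈ O, Sigma1Graph E F) {F : ℕ →. ℕ}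
    (hF : Nat.RecursiveIn O F) : Sigma1Graph E F := by
  induction hF with
  | zero =>
    intro n f g hf hg
    exact (Sigma1Def.eq hg (.const 0)).congr fun e _ => by
      exact (Part.mem_some_iff (a := 0) (b := g e)).symm
  | succ =>
    intro n f g hf hg
    exact (Sigma1Def.eq hg (hf.add (.const 1))).congr fun e _ => by simp
  | left =>
    intro n f g hf hg
    refine (Sigma1Def.ex (Sigma1Def.pair_eq hg.init last hf.init)
      (R := fun e y _ => Nat.pair (g e) y = f e)).congr fun e _ => ?_
    refine Iff.trans ?_ Part.mem_some_iff.symm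
    constructor
    · rintro ⟨y, h⟩
      simp [← h]
    · intro h
      exact ⟨_, by rw [h, Nat.pair_unpair]⟩
  | right =>
    intro n f g hf hg
    refine (Sigma1Def.ex (Sigma1Def.pair_eq last hg.init hf.init)
      (R := fun e y _ => Nat.pair y (g e) = f e)).congr fun e _ => ?_
    refine Iff.trans ?_ Part.mem_some_iff.symm
    constructor
    · rintro ⟨y, h⟩
      simp [← h]
    · intro h
      exact ⟨_, by rw [h, Nat.pair_unpair]⟩
  | oracle F hF => exact hO F hF
  | @pair F H _ _ hF hH =>
    intro n f g hf hg
    have key : Sigma1Def E fun e _ => ∃ a b, a ∈ F (f e) ∧ b ∈ H (f e) ∧ Nat.pair a b = g e :=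
      .ex (.ex ((hF _ _ _ hf.init.init last.init).and ((hH _ _ _ hf.init.init last).and
        (.pair_eq last.init last hg.init.init))))
    exact key.congr fun e _ => by simp [Seq.seq]
  | @comp F H _ _ hF hH =>
    intro n f g hf hg
    have key : Sigma1Def E fun e _ => ∃ a, a ∈ H (f e) ∧ g e ∈ F a :=
      .ex ((hH _ _ _ hf.init last).and (hF _ _ _ last hg.init))
    exact key.congr fun e _ => Part.mem_bind_iff.symm
  | prec _ _ hF hH => exact prec hF hH
  | rfind _ hF => exact rfind hF

theorem charFun {i : Fin k} {C : Set ℕ} (hC : ∀ u, E u i = C) :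
    Sigma1Graph E (TuringSet.charFun C) := by
  intro n f g hf hg
  refine (((Sigma1Def.eq hg (.const 1)).and (Delta0Def.mem hf i).sigma1Def).or
    ((Sigma1Def.eq hg (.const 0)).and (Delta0Def.mem hf i).not.sigma1Def)).congr fun e u => ?_
  by_cases h : f e ∈ C <;> simp [TuringSet.charFun, hC, h]

end Sigma1Graph

/-- A set computable from a set variable of `E` is uniformly `Σ⁰₁`, and so is its complement. -/
theorem sigma1Def_mem_of_reducible {i : Fin k} {C Z : Set ℕ} (hC : ∀ u, E u i = C)
    (hZ : TuringSet.Reducible Z C) {n : ℕ} {f : (Fin n → ℕ) → ℕ} (hf : IsTermFun f) :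
    (Sigma1Def E fun e _ => f e ∈ Z) ∧ Sigma1Def E fun e _ => f e ∉ Z := by
  have hG : Sigma1Graph E (TuringSet.charFun Z) :=
    Sigma1Graph.of_recursiveIn (O := {TuringSet.charFun C})
      (fun F hF => hF ▸ Sigma1Graph.charFun hC) (RecursiveIn.iff_nat.1 hZ)
  -- The characteristic function is total, so the complement is also `Σ⁰₁`: it is where the graph
  -- takes the value `0`.
  refine ⟨(hG _ _ _ hf (.const 1)).congr fun e u => ?_,
    (hG _ _ _ hf (.const 0)).congr fun e u => ?_⟩ <;>
  by_cases h : f e ∈ Z <;> simp [TuringSet.charFun, h]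

/-- Substitution of uniformly `Δ⁰₁` sets into a `Δ⁰₀` formula. -/
theorem Formula.IsDelta0.sigma1Def {n l : ℕ} {θ : Formula n l} (hθ : θ.IsDelta0)
    (E' : U → Fin l → Set ℕ)
    (hE' : ∀ (i : Fin l) (m : ℕ) (f : (Fin m → ℕ) → ℕ), IsTermFun f →
      (Sigma1Def E fun e u => f e ∈ E' u i) ∧ Sigma1Def E fun e u => f e ∉ E' u i) :
    (Sigma1Def E fun e u => θ.Realize Set.univ e (E' u)) ∧
      Sigma1Def E fun e u => ¬ θ.Realize Set.univ e (E' u) := by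
  -- A formula and its negation are treated together, so that the negation case just swaps them.
  induction θ with
  | eq s t =>
    have h : Delta0Def E fun e _ => s.val e = t.val e := .eq ⟨s, fun _ => rfl⟩ ⟨t, fun _ => rfl⟩
    exact ⟨h.sigma1Def, h.not.sigma1Def⟩
  | lt s t =>
    have h : Delta0Def E fun e _ => s.val e < t.val e := .lt ⟨s, fun _ => rfl⟩ ⟨t, fun _ => rfl⟩
    exact ⟨h.sigma1Def, h.not.sigma1Def⟩
  | mem t i => exact hE' i _ _ ⟨t, fun _ => rfl⟩
  | neg φ ih =>
    obtain ⟨h₁, h₂⟩ := ih hθ E' hE'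
    exact ⟨h₂, h₁.congr fun _ _ => not_not.symm⟩
  | and φ ψ ih₁ ih₂ =>
    obtain ⟨h₁, h₂⟩ := ih₁ hθ.1 E' hE'
    obtain ⟨h₃, h₄⟩ := ih₂ hθ.2 E' hE'
    exact ⟨h₁.and h₃, (h₂.or h₄).congr fun _ _ => not_and_or.symm⟩
  | @ball n l t φ ih =>
    obtain ⟨h₁, h₂⟩ := ih hθ E' hE'
    have ht : IsTermFun fun e : Fin n → ℕ => t.val e := ⟨t, fun _ => rfl⟩
    refine ⟨.ball ht (h₁.congr fun e u => ?_), (Sigma1Def.ex (.and (.lt IsTermFun.last ht.init)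
      (h₂.congr fun e u => ?_)) (R := fun e x u => x < t.val e ∧
      ¬ φ.Realize Set.univ (Fin.snoc (α := fun _ => ℕ) e x) (E' u))).congr fun e u => ?_⟩
    · rw [Fin.snoc_init_self]
    · rw [Fin.snoc_init_self]
    · simp [Formula.Realize]
  | all φ ih => exact hθ.elim
  | allSet φ ih => exact hθ.elim

/-- Replacing the set variable `0` of a `Σ⁰₁` formula by a set computable from it. -/
theorem Formula.IsSigma1.exists_of_reducible {n p : ℕ} {φ : Formula n (p + 1)} (hφ : φ.IsSigma1)
    {Z C : Set ℕ} (hZ : TuringSet.Reducible Z C) :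
    ∃ ψ : Formula n (p + 1), ψ.IsSigma1 ∧ ∀ (e : Fin n → ℕ) (V : Fin p → Set ℕ),
      ψ.Realize Set.univ e (Fin.cons C V) ↔ φ.Realize Set.univ e (Fin.cons Z V) := by
  obtain ⟨θ, hθ, rfl⟩ := hφ
  -- The parameter type `U` is the type of tuples `V`, so a single formula serves all values of the
  -- remaining set variables.
  have h := (hθ.sigma1Def (E := fun V : Fin p → Set ℕ => Fin.cons (α := fun _ => Set ℕ) C V)
    (fun V => Fin.cons (α := fun _ => Set ℕ) Z V) fun i m f hf => ?_).1
  · obtain ⟨η, hη, H⟩ := Sigma1Def.ex (R := fun e x V =>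
      θ.Realize Set.univ (Fin.snoc (α := fun _ => ℕ) e x) (Fin.cons (α := fun _ => Set ℕ) Z V))
      (h.congr fun e u => by rw [Fin.snoc_init_self])
    refine ⟨η.ex, ⟨η, hη, rfl⟩, fun e V => ?_⟩
    rw [Formula.realize_ex, Formula.realize_ex]
    exact H e V
  · refine Fin.cases ?_ (fun i => ?_) i
    · simpa using sigma1Def_mem_of_reducible (i := 0) (fun _ => by simp) hZ hf
    · exact ⟨(Delta0Def.mem hf i.succ).sigma1Def, (Delta0Def.mem hf i.succ).not.sigma1Def⟩

end SigmaRecursive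

end SecondOrderArithmetic

/-! ### Decidability relative to oracles and computability of `Δ⁰₁` sets. -/

namespace TuringSet

/-- Total functions recursive in the oracles of `O`. -/
def RecTotal (O : Set (ℕ →. ℕ)) (f : ℕ → ℕ) : Prop := Nat.RecursiveIn O fun n => Part.some (f n)

namespace RecTotal

variable {O : Set (ℕ →. ℕ)} {f g h : ℕ → ℕ}

theorem of_primrec (hf : Primrec f) : RecTotal O f := (Primrec.nat_iff.1 hf).recursiveIn

theorem comp (hf : RecTotal O f) (hg : RecTotal O g) : RecTotal O fun n => f (g n) :=
  (Nat.RecursiveIn.comp hf hg).of_eq fun n => Part.bind_some (g n) _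

theorem pair (hf : RecTotal O f) (hg : RecTotal O g) : RecTotal O fun n => Nat.pair (f n) (g n) :=
  (Nat.RecursiveIn.pair hf hg).of_eq fun n => by simp [Seq.seq]

theorem comp₂ {F : ℕ → ℕ → ℕ} (hF : Primrec₂ F) (hf : RecTotal O f) (hg : RecTotal O g) :
    RecTotal O fun n => F (f n) (g n) := by
  have : Primrec fun p : ℕ => F p.unpair.1 p.unpair.2 :=
    hF.comp (Primrec.fst.comp Primrec.unpair) (Primrec.snd.comp Primrec.unpair)
  simpa using (of_primrec this).comp (hf.pair hg)

theorem left : RecTotal O fun n => n.unpair.1 := of_primrec (Primrec.fst.comp Primrec.unpair)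

theorem right : RecTotal O fun n => n.unpair.2 := of_primrec (Primrec.snd.comp Primrec.unpair)

theorem id : RecTotal O fun n => n := of_primrec Primrec.id

theorem const (c : ℕ) : RecTotal O fun _ => c := of_primrec (Primrec.const c)

theorem prec (hf : RecTotal O f) (hh : RecTotal O h) : RecTotal O fun p =>
    Nat.rec (f p.unpair.1) (fun y i => h (Nat.pair p.unpair.1 (Nat.pair y i))) p.unpair.2 := by
  refine (Nat.RecursiveIn.prec hf hh).of_eq fun p => ?_
  change (Nat.rec (Part.some (f p.unpair.1)) (fun y IH => IH >>= fun i =>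
    Part.some (h (Nat.pair p.unpair.1 (Nat.pair y i)))) p.unpair.2 : Part ℕ) =
    Part.some (Nat.rec (f p.unpair.1) (fun y i => h (Nat.pair p.unpair.1 (Nat.pair y i)))
      p.unpair.2)
  induction p.unpair.2 with
  | zero => rfl
  | succ n ih => exact (congrArg (· >>= _) ih).trans (Part.bind_some _ _)

end RecTotal

open Classical in
/-- Predicates decidable with the oracles of `O`. -/
def RecPred (O : Set (ℕ →. ℕ)) (p : ℕ → Prop) : Prop := RecTotal O fun n => if p n then 1 else 0

theorem reducible_iff {A B : Set ℕ} : Reducible A B ↔ RecPred {charFun B} (· ∈ A) := by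
  rw [Reducible, TuringReducible, RecursiveIn.iff_nat]
  rfl

namespace RecPred

variable {O : Set (ℕ →. ℕ)} {f : ℕ → ℕ} {p q : ℕ → Prop}

theorem comp (hp : RecPred O p) (hf : RecTotal O f) : RecPred O fun n => p (f n) :=
  RecTotal.comp hp hf

theorem not (hp : RecPred O p) : RecPred O fun n => ¬ p n := by
  refine ((RecTotal.comp₂ Primrec.nat_sub (.const 1) hp)).of_eq fun n => ?_
  by_cases h : p n <;> simp [h]

theorem and (hp : RecPred O p) (hq : RecPred O q) : RecPred O fun n => p n ∧ q n := by
  refine ((RecTotal.comp₂ Primrec.nat_mul hp hq)).of_eq fun n => ?_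
  by_cases h : p n <;> by_cases h' : q n <;> simp [h, h']

theorem of_primrecRel {R : ℕ → ℕ → Prop} (hR : PrimrecRel R) {g : ℕ → ℕ}
    (hf : RecTotal O f) (hg : RecTotal O g) : RecPred O fun n => R (f n) (g n) := by
  classical
  have : Primrec₂ fun a b => if R a b then 1 else 0 :=
    Primrec.ite hR (Primrec.const 1) (Primrec.const 0)
  refine (RecTotal.comp₂ this hf hg).of_eq fun n => ?_
  by_cases h : R (f n) (g n) <;> simp [h]

/-- The truth value is the product of the truth values below the bound, computed by primitive
recursion. -/
theorem ball (hf : RecTotal O f) (hp : RecPred O p) :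
    RecPred O fun a => ∀ x < f a, p (Nat.pair a x) := by
  have hstep : RecTotal O fun n => n.unpair.2.unpair.2 *
      (open Classical in if p (Nat.pair n.unpair.1 n.unpair.2.unpair.1) then 1 else 0) :=
    .comp₂ Primrec.nat_mul (.comp .right .right)
      (hp.comp (.pair .left (.comp .left .right)))
  refine ((RecTotal.prec (.const 1) hstep).comp (.pair .id hf)).of_eq fun a => ?_
  classical
  have key : ∀ m : ℕ, (Nat.rec 1 (fun y i => i * if p (Nat.pair a y) then 1 else 0) m : ℕ) =
      if ∀ x < m, p (Nat.pair a x) then 1 else 0 := fun m => by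
    induction m with
    | zero => simp
    | succ n ih =>
      simp only [ih, Nat.lt_succ_iff_lt_or_eq, or_imp, forall_and, forall_eq]
      by_cases h : ∀ x < n, p (Nat.pair a x) <;> by_cases h' : p (Nat.pair a n) <;> simp [h, h']
  simp only [Nat.unpair_pair]
  congr 1
  convert key (f a)

/-- Unbounded search. Since `Nat.rfind` looks for a zero, it is applied to the characteristic
function of the negation. -/
theorem exists_search (hp : RecPred O p) (h : ∀ a, ∃ y, p (Nat.pair a y)) :
    ∃ g, RecTotal O g ∧ ∀ a, p (Nat.pair a (g a)) := by
  classical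
  refine ⟨fun a => Nat.find (h a), (Nat.RecursiveIn.rfind hp.not).of_eq_tot fun a => ?_,
    fun a => Nat.find_spec (h a)⟩
  refine Nat.mem_rfind.2 ⟨?_, fun {m} hm => ?_⟩
  · simpa using Nat.find_spec (h a)
  · simpa using Nat.find_min (h a) hm

end RecPred

/-- Decoding of tuples: the inverse of iterated pairing. -/
def tuple : (n : ℕ) → ℕ → Fin n → ℕ
  | 0, _ => Fin.elim0
  | n + 1, a => Fin.snoc (α := fun _ => ℕ) (tuple n a.unpair.1) a.unpair.2

theorem tuple_surjective : ∀ n, Function.Surjective (tuple n)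
  | 0, e => ⟨0, Subsingleton.elim _ _⟩
  | n + 1, e => by
    obtain ⟨a, ha⟩ := tuple_surjective n (Fin.init e)
    exact ⟨Nat.pair a (e (Fin.last n)), by simp [tuple, ha, Fin.snoc_init_self]⟩

theorem recTotal_tuple {O : Set (ℕ →. ℕ)} : ∀ {n : ℕ} (i : Fin n), RecTotal O fun a => tuple n a i
  | n + 1, i => by
    refine Fin.lastCases ?_ (fun i => ?_) i
    · simpa [tuple] using RecTotal.right
    · simpa [tuple] using (recTotal_tuple i).comp .left

open SecondOrderArithmetic

theorem recTotal_val {O : Set (ℕ →. ℕ)} {n : ℕ} (t : NumTerm n) :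
    RecTotal O fun a => t.val (tuple n a) := by
  induction t with
  | var i => exact recTotal_tuple i
  | zero => exact .const 0
  | one => exact .const 1
  | add s t hs ht => exact .comp₂ Primrec.nat_add hs ht
  | mul s t hs ht => exact .comp₂ Primrec.nat_mul hs ht

theorem recPred_realize {D : Set ℕ} {n k : ℕ} {θ : Formula n k} (hθ : θ.IsDelta0)
    (E : Fin k → Set ℕ) (hE : ∀ i, Reducible (E i) D) :
    RecPred {charFun D} fun a => θ.Realize Set.univ (tuple n a) E := by
  induction θ with
  | eq s t => exact .of_primrecRel Primrec.eq (recTotal_val s) (recTotal_val t)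
  | lt s t => exact .of_primrecRel Primrec.nat_lt (recTotal_val s) (recTotal_val t)
  | mem t i => exact (reducible_iff.1 (hE i)).comp (recTotal_val t)
  | neg φ ih => exact (ih hθ E hE).not
  | and φ ψ ih₁ ih₂ => exact (ih₁ hθ.1 E hE).and (ih₂ hθ.2 E hE)
  | ball t φ ih =>
    simpa [Formula.Realize, tuple] using RecPred.ball (recTotal_val t) (ih hθ E hE)
  | all φ ih => exact hθ.elim
  | allSet φ ih => exact hθ.elim

/-- `Δ⁰₁` comprehension for the sets below a Turing degree. -/
theorem reducible_of_delta1 {D : Set ℕ} {n k : ℕ} {θ η : Formula (n + 1 + 1) k}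
    (hθ : θ.IsDelta0) (hη : η.IsDelta0) (E : Fin k → Set ℕ) (hE : ∀ i, Reducible (E i) D)
    (e : Fin n → ℕ)
    (h : ∀ x, θ.ex.Realize Set.univ (Fin.snoc (α := fun _ => ℕ) e x) E ↔
      η.all.Realize Set.univ (Fin.snoc (α := fun _ => ℕ) e x) E) :
    Reducible {x | θ.ex.Realize Set.univ (Fin.snoc (α := fun _ => ℕ) e x) E} D := by
  obtain ⟨c, rfl⟩ := tuple_surjective n e
  have hpos := recPred_realize hθ E hE
  have hneg := (recPred_realize hη E hE).not
  have hc : RecTotal {charFun D} fun a => Nat.pair (Nat.pair c a.unpair.1) a.unpair.2 :=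
    .pair (.pair (.const c) .left) .right
  -- For each `x`, search for a number that is a witness for `θ` or a counterexample to `η`. The
  -- equivalence `h` makes the search total.
  obtain ⟨g, hg, H⟩ := (((hpos.comp hc).not.and (hneg.comp hc).not).not).exists_search fun x => by
    by_contra! hx
    have hx' := h x
    rw [Formula.realize_ex] at hx'
    simp only [Formula.Realize, Nat.unpair_pair, tuple] at hx hx'
    exact (hx 0).1 ((hx'.2 fun y => (hx y).2).elim fun y hy => absurd hy (hx y).1)
  refine reducible_iff.2 ?_
  -- Membership of `x` is decided by whether the number found witnesses `θ`: for a member, `η` has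
  -- no counterexample.
  have key := hpos.comp (hc.comp (.pair .id hg))
  convert key using 2 with x
  have hx := H x
  have hx' := h x
  rw [Formula.realize_ex] at hx'
  simp only [Set.mem_ofPred_eq, Formula.realize_ex, Formula.Realize, Nat.unpair_pair, tuple,
    not_and_or, not_not] at hx hx' ⊢
  refine ⟨fun hx₁ => ?_, fun hx₁ => ⟨_, hx₁⟩⟩
  exact hx.resolve_right fun hn => hn (hx'.1 hx₁ _)

/-- With this, the basic reductions between sets and joins follow from explicit `Δ⁰₀` definitions.
-/
theorem reducible_of_delta0Def {D : Set ℕ} {k : ℕ} (E : Fin k → Set ℕ)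
    (hE : ∀ i, Reducible (E i) D) {R : (Fin 1 → ℕ) → Unit → Prop}
    (hR : Delta0Def (fun _ : Unit => E) R) : Reducible {x | R (fun _ => x) ()} D := by
  obtain ⟨θ, hθ, H⟩ := hR
  have key := (recPred_realize hθ E hE).comp (.pair (.const 0) .id)
  refine reducible_iff.2 ?_
  convert key using 2 with x
  rw [H _ ()]
  simp only [Set.mem_ofPred_eq, tuple, Nat.unpair_pair]
  refine Iff.of_eq (congrArg (R · ()) (funext fun i => ?_))
  rw [Subsingleton.elim i (Fin.last 0), Fin.snoc_last]

/-! ### Reductions involving joins, and countability of lower cones. -/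

namespace Reducible

theorem refl (A : Set ℕ) : Reducible A A := TuringReducible.refl _

theorem trans {A B C : Set ℕ} (h₁ : Reducible A B) (h₂ : Reducible B C) : Reducible A C :=
  TuringReducible.trans h₁ h₂

theorem empty (A : Set ℕ) : Reducible ∅ A := by
  simpa using reducible_of_delta0Def ![A] (by simp [refl])
    (Delta0Def.lt (f := fun e => e 0) (.var 0) (.var 0))

theorem left_of_join {A B C : Set ℕ} (h : Reducible (join A B) C) : Reducible A C := by
  have key := reducible_of_delta0Def ![join A B] (by simpa using h)
    (Delta0Def.mem ((IsTermFun.const 2).mul (.var 0)) 0)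
  convert key using 1
  ext x
  simp [join]
  grind

theorem right_of_join {A B C : Set ℕ} (h : Reducible (join A B) C) : Reducible B C := by
  have key := reducible_of_delta0Def ![join A B] (by simpa using h)
    (Delta0Def.mem (((IsTermFun.const 2).mul (.var 0)).add (.const 1)) 0)
  convert key using 1
  ext x
  simp [join]
  grind

theorem join {A B C : Set ℕ} (hA : Reducible A C) (hB : Reducible B C) :
    Reducible (join A B) C := by
  have key := reducible_of_delta0Def ![A, B] (Fin.forall_fin_two.2 ⟨hA, hB⟩)
    (R := fun e _ => ∃ y < e 0 + 1, (e 0 = 2 * y ∧ y ∈ A) ∨ (e 0 = 2 * y + 1 ∧ y ∈ B))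
    (.bex ((IsTermFun.var 0).add (.const 1)) (.or
      (.and (.eq (.var 0) (.mul (.const 2) .last)) (.mem .last 0))
      (.and (.eq (.var 0) (.add (.mul (.const 2) .last) (.const 1))) (.mem .last 1))))
  convert key using 1
  ext x
  simp only [TuringSet.join, Set.mem_union, Set.mem_image, Set.mem_ofPred_eq]
  grind

end Reducible

/-- Only countably many partial functions are recursive in countably many oracles. -/
theorem countable_recursiveIn {O : Set (ℕ →. ℕ)} (hO : O.Countable) :
    {f | Nat.RecursiveIn O f}.Countable := by
  let pairing (f h : ℕ →. ℕ) : ℕ →. ℕ := fun n => Nat.pair <$> f n <*> h n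
  let comp (f h : ℕ →. ℕ) : ℕ →. ℕ := fun n => h n >>= f
  let prec (f h : ℕ →. ℕ) : ℕ →. ℕ := fun p =>
    let (a, n) := Nat.unpair p
    n.rec (f a) fun y IH => do
      let i ← IH
      h (Nat.pair a (Nat.pair y i))
  let mu (f : ℕ →. ℕ) : ℕ →. ℕ := fun a =>
    Nat.rfind fun n => (fun m => m = 0) <$> f (Nat.pair a n)
  -- One round of closure under the generating operations. Iterating from the countable set of basic
  -- functions gives countable levels that exhaust the recursive functions.
  let next (L : Set (ℕ →. ℕ)) : Set (ℕ →. ℕ) :=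
    L ∪ Set.image2 pairing L L ∪ Set.image2 comp L L ∪ Set.image2 prec L L ∪ mu '' L
  let base : Set (ℕ →. ℕ) := O ∪ {fun _ => 0, fun n => Part.some n.succ,
    fun n => Part.some (Nat.unpair n).1, fun n => Part.some (Nat.unpair n).2}
  let level (n : ℕ) : Set (ℕ →. ℕ) := next^[n] base
  have hlevel : ∀ n, level (n + 1) = next (level n) := fun n => Function.iterate_succ_apply' _ _ _
  have hcount : ∀ n, (level n).Countable := by
    intro n
    induction n with
    | zero => exact hO.union ((((Set.countable_singleton _).insert _).insert _).insert _)
    | succ n ih =>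
      rw [hlevel]
      exact (((ih.union (ih.image2 ih _)).union (ih.image2 ih _)).union
        (ih.image2 ih _)).union (ih.image _)
  have hmono : Monotone level := monotone_nat_of_le_succ fun n => by
    rw [hlevel]
    intro f hf
    simp only [next, Set.mem_union]
    tauto
  refine (Set.countable_iUnion hcount).mono fun f hf => Set.mem_iUnion.2 ?_
  induction hf with
  | zero => exact ⟨0, Or.inr (Or.inl rfl)⟩
  | succ => exact ⟨0, Or.inr (Or.inr (Or.inl rfl))⟩
  | left => exact ⟨0, Or.inr (Or.inr (Or.inr (Or.inl rfl)))⟩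
  | right => exact ⟨0, Or.inr (Or.inr (Or.inr (Or.inr rfl)))⟩
  | oracle g hg => exact ⟨0, Or.inl hg⟩
  | @pair f h _ _ ihf ihh =>
    obtain ⟨⟨a, ha⟩, b, hb⟩ := And.intro ihf ihh
    refine ⟨max a b + 1, ?_⟩
    rw [hlevel]
    exact .inl (.inl (.inl (.inr ⟨f, hmono (le_max_left a b) ha, h, hmono (le_max_right a b) hb,
      rfl⟩)))
  | @comp f h _ _ ihf ihh =>
    obtain ⟨⟨a, ha⟩, b, hb⟩ := And.intro ihf ihh
    refine ⟨max a b + 1, ?_⟩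
    rw [hlevel]
    exact .inl (.inl (.inr ⟨f, hmono (le_max_left a b) ha, h, hmono (le_max_right a b) hb, rfl⟩))
  | @prec f h _ _ ihf ihh =>
    obtain ⟨⟨a, ha⟩, b, hb⟩ := And.intro ihf ihh
    refine ⟨max a b + 1, ?_⟩
    rw [hlevel]
    exact .inl (.inr ⟨f, hmono (le_max_left a b) ha, h, hmono (le_max_right a b) hb, rfl⟩)
  | @rfind f _ ihf =>
    obtain ⟨a, ha⟩ := ihf
    refine ⟨a + 1, ?_⟩
    rw [hlevel]
    exact .inr ⟨f, ha, rfl⟩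

theorem charFun_injective : Function.Injective charFun := by
  intro A B h
  ext n
  have hn := congrFun h n
  by_cases hA : n ∈ A <;> by_cases hB : n ∈ B <;> simp_all [charFun]

/-- The sets computable from `D` can be listed. -/
theorem exists_range_eq_reducible (D : Set ℕ) :
    ∃ L : ℕ → Set ℕ, Set.range L = {Z | Reducible Z D} := by
  have hc : {Z | Reducible Z D}.Countable :=
    ((countable_recursiveIn (Set.countable_singleton (charFun D))).preimage
      charFun_injective).mono fun Z hZ => RecursiveIn.iff_nat.1 hZ
  obtain ⟨L, hL⟩ := hc.exists_eq_range ⟨D, Reducible.refl D⟩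
  exact ⟨L, hL.symm⟩

end TuringSet

/-! ### Downward closure of fairness. -/

namespace Fairness

open SecondOrderArithmetic TuringSet

/-- The `Σ⁰₁` formula with oracle `Z` is rewritten with oracle `C` so that it holds of exactly the
same valuations; essentiality and the diagonalizing valuation transfer with the same `n`. -/
theorem IsNFair.of_reducible {n : ℕ} {Z C : Set ℕ} {A₀ A₁ : Set (List Bool)}
    (hC : IsNFair n C A₀ A₁) (hZ : Reducible Z C) : IsNFair n Z A₀ A₁ := by
  intro m φ hφ M hM hess
  obtain ⟨ψ, hψ, H⟩ := hφ.exists_of_reducible hZ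
  have key : ∀ V, Holds ψ C V ↔ Holds φ Z V := fun V =>
    (Formula.sat_omega _ _ _ _).trans ((H _ _).trans (Formula.sat_omega _ _ _ _).symm)
  obtain ⟨V, hV, hdiag, hψV⟩ := hC m ψ hψ M hM fun s => by
    obtain ⟨V, hV, hs, hφV⟩ := hess s
    exact ⟨V, hV, hs, (key V).2 hφV⟩
  exact ⟨V, hV, hdiag, (key V).1 hψV⟩

/-- Fairness is inherited by sets of lower Turing degree. -/
theorem IsFair.of_reducible {Z C : Set ℕ} {A₀ A₁ : Set (List Bool)}
    (hC : IsFair C A₀ A₁) (hZ : Reducible Z C) : IsFair Z A₀ A₁ := by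
  obtain ⟨n, hn, h⟩ := hC
  exact ⟨n, hn, h.of_reducible hZ⟩

end Fairness

/-! ### The ideal generated by a sequence of sets. -/

namespace TuringSet

theorem Reducible.joinUpTo_of_le (X : ℕ → Set ℕ) {s t : ℕ} (h : s ≤ t) :
    Reducible (joinUpTo X s) (joinUpTo X t) := by
  induction t, h using Nat.le_induction with
  | base => exact .refl _
  | succ t _ ih => exact ih.trans (Reducible.refl (joinUpTo X (t + 1))).left_of_join

theorem Reducible.self_joinUpTo (X : ℕ → Set ℕ) : ∀ s, Reducible (X s) (joinUpTo X s)
  | 0 => .refl _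
  | s + 1 => (Reducible.refl (joinUpTo X (s + 1))).right_of_join

theorem joinUpTo_congr {X Y : ℕ → Set ℕ} :
    ∀ {s : ℕ}, (∀ t ≤ s, X t = Y t) → joinUpTo X s = joinUpTo Y s
  | 0, h => h 0 le_rfl
  | s + 1, h => by
    rw [joinUpTo, joinUpTo, joinUpTo_congr fun t ht => h t (Nat.le_succ_of_le ht), h _ le_rfl]

/-- The sets computable from some finite join of the sequence `X`. -/
def idealOf (X : ℕ → Set ℕ) : Set (Set ℕ) := {Z | ∃ s, Reducible Z (joinUpTo X s)}

theorem isIdeal_idealOf (X : ℕ → Set ℕ) : IsIdeal (idealOf X) where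
  nonempty := ⟨X 0, 0, .refl _⟩
  downward_closed := fun _ _ ⟨s, hs⟩ h => ⟨s, h.trans hs⟩
  join_closed := fun _ _ ⟨s, hs⟩ ⟨t, ht⟩ => ⟨max s t,
    (hs.trans (.joinUpTo_of_le X (le_max_left s t))).join
      (ht.trans (.joinUpTo_of_le X (le_max_right s t)))⟩

theorem exists_reducible_joinUpTo {X : ℕ → Set ℕ} {k : ℕ} {E : Fin k → Set ℕ}
    (hE : ∀ i, E i ∈ idealOf X) : ∃ s, ∀ i, Reducible (E i) (joinUpTo X s) := by
  choose s hs using hE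
  exact ⟨Finset.univ.sup s, fun i =>
    (hs i).trans (.joinUpTo_of_le X (Finset.le_sup (Finset.mem_univ i)))⟩

end TuringSet

/-! ### Truth in the ω-model of a Turing ideal. -/

namespace SecondOrderArithmetic

open TuringSet

/-- Induction is true induction on `ℕ`. For comprehension, the finitely many set parameters lie
below one join, which then computes the `Δ⁰₁` set. -/
theorem modelsRCA0_idealOf (X : ℕ → Set ℕ) : (L2Structure.omega (idealOf X)).ModelsRCA0 where
  succ_ne_zero := Nat.succ_ne_zero
  succ_inj _ _ := Nat.succ.inj
  add_zero := Nat.add_zero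
  add_succ := Nat.add_succ
  mul_zero := Nat.mul_zero
  mul_succ := Nat.mul_succ
  not_lt_zero := Nat.not_lt_zero
  lt_succ _ _ := Nat.lt_succ_iff_lt_or_eq
  sigma1_induction _ _ _ _ _ _ _ h₀ h x := Nat.rec h₀ (fun x ih => h x ih) x
  delta1_comprehension n k φ ψ hφ hψ e E hE h := by
    obtain ⟨θ, hθ, rfl⟩ := hφ
    obtain ⟨η, hη, rfl⟩ := hψ
    obtain ⟨s, hs⟩ := exists_reducible_joinUpTo hE
    have habs : ∀ {l} {ρ : Formula l k}, ρ.IsArithmetical → ∀ d : Fin l → ℕ,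
        (L2Structure.omega (idealOf X)).Sat ρ d E ↔ ρ.Realize Set.univ d E := fun hρ d =>
      (Formula.sat_omega _ _ _ _).trans (hρ.realize_iff _ _ _ _)
    have hθ' : θ.ex.IsArithmetical := hθ.isArithmetical
    have hη' : η.all.IsArithmetical := hη.isArithmetical
    exact ⟨_, ⟨s, reducible_of_delta1 hθ hη E hs e fun x =>
      (habs hθ' _).symm.trans ((h x).trans (habs hη' _))⟩, fun x => (habs hθ' _).symm⟩

theorem Principle.models_sentence_iff (P : Principle) (S : Set (Set ℕ)) :
    (L2Structure.omega S).Models P.sentence ↔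
      ∀ J ∈ S, P.IsInstance J → ∃ Y ∈ S, P.IsSolution J Y := by
  refine (Formula.sat_omega _ _ _ _).trans (forall₂_congr fun J _ => ?_)
  refine (Formula.realize_imp _ _ _ _ _).trans ?_
  have h₁ : (Fin.snoc (α := fun _ => Set ℕ) Fin.elim0 J : Fin 1 → Set ℕ) = ![J] :=
    funext fun i => by fin_cases i; rfl
  have h₂ : ∀ Y, (Fin.snoc (α := fun _ => Set ℕ) ![J] Y : Fin 2 → Set ℕ) = ![J, Y] := fun Y =>
    funext fun i => by fin_cases i <;> rfl
  refine imp_congr ?_ ((Formula.realize_exSet _ _ _ _).trans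
    (exists_congr fun Y => and_congr_right fun _ => ?_))
  · exact (P.inst_arithmetical.realize_iff _ Set.univ _ _).trans
      ((Iff.of_eq (congrArg _ h₁)).trans (Formula.sat_omega _ _ _ _).symm)
  · exact (P.sol_arithmetical.realize_iff _ Set.univ _ _).trans
      ((Iff.of_eq (congrArg _ ((congrArg (Fin.snoc (α := fun _ => Set ℕ) · Y) h₁).trans
        (h₂ Y)))).trans (Formula.sat_omega _ _ _ _).symm)

end SecondOrderArithmetic

/-! ### The iterated construction with bookkeeping. -/

namespace Fairness

open SecondOrderArithmetic TuringSet

/-- One step of the construction: given a fair set `D` and a set `K`, some `Y` preserves fairness,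
solves some instance below `D` if there is one, and solves `K` if `K` is an instance below `D`. -/
theorem AdmitsPreservation.exists_step {P : Principle} (hP : AdmitsPreservation P)
    {A₀ A₁ : Set (List Bool)} {D : Set ℕ} (hD : IsFair D A₀ A₁) (K : Set ℕ) :
    ∃ Y : Set ℕ, IsFair (join D Y) A₀ A₁ ∧
      ((∃ J, Reducible J D ∧ P.IsInstance J) →
        ∃ J, Reducible J D ∧ P.IsInstance J ∧ P.IsSolution J Y) ∧
      (Reducible K D → P.IsInstance K → P.IsSolution K Y) := by
  have hsolve : ∀ J, Reducible J D → P.IsInstance J →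
      ∃ Y, P.IsSolution J Y ∧ IsFair (join D Y) A₀ A₁ := fun J hJ hJ' => by
    obtain ⟨Y, hY, hfair⟩ := hP A₀ A₁ D hD J hJ hJ'
    exact ⟨Y, hY, hfair.of_reducible
      ((Reducible.refl _).right_of_join.join (Reducible.refl _).left_of_join)⟩
  by_cases hK : Reducible K D ∧ P.IsInstance K
  · obtain ⟨Y, hY, hfair⟩ := hsolve K hK.1 hK.2
    exact ⟨Y, hfair, fun _ => ⟨K, hK.1, hK.2, hY⟩, fun _ _ => hY⟩
  · by_cases hJ : ∃ J, Reducible J D ∧ P.IsInstance J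
    · obtain ⟨J, hJ, hJ'⟩ := hJ
      obtain ⟨Y, hY, hfair⟩ := hsolve J hJ hJ'
      exact ⟨Y, hfair, fun _ => ⟨J, hJ, hJ', hY⟩, fun h h' => absurd ⟨h, h'⟩ hK⟩
    -- With nothing to solve, the empty set is added, which keeps the Turing degree.
    · exact ⟨∅, hD.of_reducible ((Reducible.refl D).join (.empty D)), fun h => absurd h hJ,
        fun h h' => absurd ⟨h, h'⟩ hK⟩

/-- A sequence of successive solutions, starting from a fair set `C`, that meets all instances
computable from its finite joins. -/
theorem AdmitsPreservation.exists_sequence {P : Principle} (hP : AdmitsPreservation P)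
    {A₀ A₁ : Set (List Bool)} {C : Set ℕ} (hC : IsFair C A₀ A₁) :
    ∃ X : ℕ → Set ℕ, X 0 = C ∧ (∀ s, IsFair (joinUpTo X s) A₀ A₁) ∧
      (∀ s, (∃ J, Reducible J (joinUpTo X s) ∧ P.IsInstance J) →
        ∃ J, Reducible J (joinUpTo X s) ∧ P.IsInstance J ∧ P.IsSolution J (X (s + 1))) ∧
      ∀ J s, Reducible J (joinUpTo X s) → P.IsInstance J → ∃ t, P.IsSolution J (X t) := by
  choose list hlist using exists_range_eq_reducible
  -- Stage `s` treats set number `s.unpair.2` in the list of sets below the join up to `s.unpair.1 ≤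
  -- s`. Fairness is a premise inside the existential so that `next` can be chosen for arbitrary
  -- `H`.
  have hstep : ∀ (s : ℕ) (H : ℕ → Set ℕ), ∃ Y, IsFair (joinUpTo H s) A₀ A₁ →
      IsFair (join (joinUpTo H s) Y) A₀ A₁ ∧
      ((∃ J, Reducible J (joinUpTo H s) ∧ P.IsInstance J) →
        ∃ J, Reducible J (joinUpTo H s) ∧ P.IsInstance J ∧ P.IsSolution J Y) ∧
      (Reducible (list (joinUpTo H s.unpair.1) s.unpair.2) (joinUpTo H s) →
        P.IsInstance (list (joinUpTo H s.unpair.1) s.unpair.2) →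
        P.IsSolution (list (joinUpTo H s.unpair.1) s.unpair.2) Y) := fun s H => by
    by_cases h : IsFair (joinUpTo H s) A₀ A₁
    · obtain ⟨Y, hY⟩ := hP.exists_step h (list (joinUpTo H s.unpair.1) s.unpair.2)
      exact ⟨Y, fun _ => hY⟩
    · exact ⟨∅, fun h' => absurd h' h⟩
  choose next hnext using hstep
  -- Each choice depends on all earlier sets, so the recursion carries a whole sequence. Entries of
  -- `history s` beyond `s` are still the default `C`, but joins up to `s` do not see them; the
  -- diagonal is the desired sequence.
  let history : ℕ → ℕ → Set ℕ := fun s =>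
    Nat.rec (fun _ => C) (fun s H => Function.update H (s + 1) (next s H)) s
  have hhist : ∀ s, history (s + 1) = Function.update (history s) (s + 1) (next s (history s)) :=
    fun _ => rfl
  have hagree : ∀ t s, t ≤ s → history t t = history s t := by
    intro t s h
    induction s, h using Nat.le_induction with
    | base => rfl
    | succ s hs ih => rw [ih, hhist, Function.update_of_ne (by omega)]
  have hjoin : ∀ t s, t ≤ s → joinUpTo (history s) t = joinUpTo (fun s => history s s) t :=
    fun t s h => joinUpTo_congr fun r hr => (hagree r s (hr.trans h)).symm
  have hX : ∀ s, history (s + 1) (s + 1) = next s (history s) := fun s => by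
    rw [hhist, Function.update_self]
  have hfair : ∀ s, IsFair (joinUpTo (fun s => history s s) s) A₀ A₁ := by
    intro s
    induction s with
    | zero => exact hC
    | succ s ih =>
      rw [← hjoin s s le_rfl] at ih
      have := (hnext s (history s) ih).1
      rwa [hjoin s s le_rfl, ← hX] at this
  have hspec := fun s => (hnext s (history s) ((hjoin s s le_rfl).symm ▸ hfair s)).2
  simp only [hjoin _ _ le_rfl, hjoin _ _ (Nat.unpair_left_le _), ← hX] at hspec
  refine ⟨fun s => history s s, rfl, hfair, fun s => (hspec s).1, fun J s hJ hJ' => ?_⟩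
  obtain ⟨i, rfl⟩ : J ∈ Set.range (list (joinUpTo (fun s => history s s) s)) := by
    rw [hlist]
    exact hJ
  have h := (hspec (Nat.pair s i)).2
  rw [Nat.unpair_pair] at h
  -- The instance with index `i` below the join up to `s` is treated at stage `Nat.pair s i ≥ s`,
  -- where it is still computable from the current join.
  exact ⟨Nat.pair s i + 1, h (hJ.trans (.joinUpTo_of_le _ (Nat.left_le_pair s i))) hJ'⟩

end Fairness

theorem mainTheorem10
    (P Q : SecondOrderArithmetic.Principle)
    (hP : Fairness.AdmitsPreservation P)
    (hQ : ¬ Fairness.AdmitsPreservation Q) :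
    ¬ SecondOrderArithmetic.ImpliesOverRCA0 P Q ∧
    ∃ (A₀ A₁ : Set (List Bool)) (X : ℕ → Set ℕ) (I : Set (Set ℕ)),
      -- `I` is the Turing ideal generated by fair joins of successive solutions to `P`-instances
      (∀ s : ℕ, Fairness.IsFair (TuringSet.joinUpTo X s) A₀ A₁) ∧
      (∀ s : ℕ,
        (∃ J : Set ℕ, TuringSet.Reducible J (TuringSet.joinUpTo X s) ∧ P.IsInstance J) →
        ∃ J : Set ℕ, TuringSet.Reducible J (TuringSet.joinUpTo X s) ∧ P.IsInstance J ∧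
          P.IsSolution J (X (s + 1))) ∧
      I = {Z : Set ℕ | ∃ s : ℕ, TuringSet.Reducible Z (TuringSet.joinUpTo X s)} ∧
      TuringSet.IsIdeal I ∧
      -- a `Q`-instance in `I` without solution in `I`
      (∃ J : Set ℕ, TuringSet.Reducible J (X 0) ∧ Q.IsInstance J ∧
        ∀ Z ∈ I, ¬ Q.IsSolution J Z) ∧
      -- the `ω`-model with second-order part `I` separates `P` from `Q` over `RCA₀`
      (SecondOrderArithmetic.L2Structure.omega I).ModelsRCA0 ∧
      (SecondOrderArithmetic.L2Structure.omega I).Models P.sentence ∧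
      ¬ (SecondOrderArithmetic.L2Structure.omega I).Models Q.sentence := by
  have hQ' : ∃ A₀ A₁ C, Fairness.IsFair C A₀ A₁ ∧ ∃ J, TuringSet.Reducible J C ∧
      Q.IsInstance J ∧ ∀ Y, Q.IsSolution J Y → ¬ Fairness.IsFair (TuringSet.join Y C) A₀ A₁ := by
    unfold Fairness.AdmitsPreservation at hQ
    push Not at hQ
    exact hQ
  obtain ⟨A₀, A₁, C, hC, J, hJC, hJ, hJsol⟩ := hQ'
  obtain ⟨X, rfl, hfair, hsolve, hall⟩ := hP.exists_sequence hC
  have hnosol : ∀ Z ∈ TuringSet.idealOf X, ¬ Q.IsSolution J Z := by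
    rintro Z ⟨s, hs⟩ hZ
    -- Both `Z` and `X 0` lie below the fair join up to `s`, so `Z ⊕ X 0` is fair, against the
    -- choice of `J`.
    exact hJsol Z hZ ((hfair s).of_reducible
      (hs.join (TuringSet.Reducible.joinUpTo_of_le X (Nat.zero_le s))))
  have hRCA := SecondOrderArithmetic.modelsRCA0_idealOf X
  have hmodP : (SecondOrderArithmetic.L2Structure.omega (TuringSet.idealOf X)).Models
      P.sentence := by
    rw [P.models_sentence_iff]
    rintro K ⟨s, hs⟩ hK
    obtain ⟨t, ht⟩ := hall K s hs hK
    exact ⟨X t, ⟨t, TuringSet.Reducible.self_joinUpTo X t⟩, ht⟩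
  have hmodQ : ¬ (SecondOrderArithmetic.L2Structure.omega (TuringSet.idealOf X)).Models
      Q.sentence := by
    rw [Q.models_sentence_iff]
    intro h
    obtain ⟨Z, hZ, hsol⟩ := h J ⟨0, hJC⟩ hJ
    exact hnosol Z hZ hsol
  exact ⟨fun h => hmodQ (h _ hRCA hmodP), A₀, A₁, X, TuringSet.idealOf X, hfair, hsolve, rfl,
    TuringSet.isIdeal_idealOf X, ⟨J, hJC, hJ, hnosol⟩, hRCA, hmodP, hmodQ⟩
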